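/- Let $\mathbf t = t_0t_1t_2\cdots = 01101001\cdots$ be the Thue–Morse word, where $t_i\in\{0,1\}$ is the sum modulo $2$ of the binary digits of $i$. For $n\ge 0$ let $c(n)$ be its cyclic complexity, that is, the number of length-$n$ factors (blocks $t_it_{i+1}\cdots t_{i+n-1}$, $i \ge 0$) of $\mathbf t$, where factors that are cyclic shifts of one another are counted only once. Then $$\limsup_{n\to\infty}\frac{c(n)}{n}=2 .$$ -/

import Mathlib

/-- The factor (block of consecutive letters) of length `n` of the infinite word `x`
starting at position `i`, i.e. `x i, x (i + 1), …, x (i + n - 1)`. -/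
def wordFactor {α : Type*} (x : ℕ → α) (i n : ℕ) : List α :=
  (List.range n).map fun j => x (i + j)

/-- The set of length-`n` factors of the infinite word `x`, up to cyclic rotation
(`Cycle α` is the type of lists over `α` modulo rotation). -/
def cyclicFactors {α : Type*} (x : ℕ → α) (n : ℕ) : Set (Cycle α) :=
  {w | ∃ i : ℕ, w = (wordFactor x i n : Cycle α)}

/-- Over a finite alphabet there are only finitely many factors of a given length up to
rotation, so that the cardinality below is a genuine count. -/
theorem cyclicFactors_finite {α : Type*} [Finite α] (x : ℕ → α) (n : ℕ) :
    (cyclicFactors x n).Finite := by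
  refine ((List.finite_length_eq α n).image (fun l : List α => (l : Cycle α))).subset ?_
  rintro w ⟨i, rfl⟩
  exact ⟨wordFactor x i n, by simp [wordFactor], rfl⟩

/-- The cyclic complexity function of an infinite word over a finite alphabet: the number of
its length-`n` factors, counted up to cyclic rotation. -/
noncomputable def cyclicComplexity {α : Type*} [Finite α] (x : ℕ → α) (n : ℕ) : ℕ :=
  (cyclicFactors x n).ncard

/-- The Thue–Morse word `0 1 1 0 1 0 0 1 …`: its `n`-th letter is the sum modulo 2 of the
binary digits of `n`. -/
def thueMorse (n : ℕ) : Fin 2 :=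
  Fin.ofNat 2 (Nat.digits 2 n).sum

/-! ### Rotation classes of windows in an arbitrary word. -/

section Windows

variable {α : Type*} (x : ℕ → α)

/-! Write `u(n)` and `b(n)` for the numbers of factors of length `n + 1` with distinct, resp. equal,
end letters. Sliding a window past equal end letters only rotates it, so `c(n) ≤ u(n)`. Undoing the
morphism `0 ↦ 01`, `1 ↦ 10` bounds `u` and `b` at `2m` and `2m + 1` by their values at `m` and `m +
1`, whence `u(n) ≤ 2n` (`ncard_unbalancedFactors_le_and_ncard_balancedFactors_le`).

Conversely, the absence of `01010` and `10101` makes desubstitution rigid: `u(2m) ≥ 2u(m)` and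
`c(2m) ≥ c(m) + u(m)` for `m` not too small (`cyclicComplexity_add_ncard_unbalancedFactors_le`).
Along powers of two this gives `c(n) ≥ 2n - 16`, so the ratio tends to `2` there. -/

@[simp] theorem length_wordFactor (i n : ℕ) : (wordFactor x i n).length = n := by
  simp [wordFactor]

theorem wordFactor_eq_iff {i j n : ℕ} :
    wordFactor x i n = wordFactor x j n ↔ ∀ k < n, x (i + k) = x (j + k) := by
  simp [wordFactor]

theorem tail_wordFactor (i n : ℕ) : (wordFactor x i (n + 1)).tail = wordFactor x (i + 1) n := by
  refine List.ext_getElem (by simp) fun k _ _ => ?_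
  simp [wordFactor, Nat.add_right_comm, Nat.add_assoc]

theorem dropLast_wordFactor (i n : ℕ) :
    (wordFactor x i (n + 1)).dropLast = wordFactor x i n := by
  refine List.ext_getElem (by simp) fun k _ _ => ?_
  simp [wordFactor]

/-- Two windows are rotations of each other exactly when they agree after a cyclic shift. -/
theorem coe_wordFactor_eq_iff {i j n : ℕ} :
    (wordFactor x i n : Cycle α) = wordFactor x j n ↔
      ∃ s ≤ n, (∀ k, k + s < n → x (j + k) = x (i + (k + s))) ∧
        ∀ k < n, n ≤ k + s → x (j + k) = x (i + (k + s - n)) := by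
  rw [Cycle.coe_eq_coe, List.isRotated_iff_mod]
  simp only [length_wordFactor]
  refine exists_congr fun s => and_congr_right fun hs => ?_
  constructor
  · intro h
    have key : ∀ k < n, x (j + k) = x (i + (k + s) % n) := by
      intro k hk
      have := congrArg (fun l : List α => l[k]?) h
      rw [List.getElem?_rotate (by simpa using hk)] at this
      have hm : (k + s) % n < n := Nat.mod_lt _ (by omega)
      simpa [wordFactor, hk, hm, eq_comm] using this
    refine ⟨fun k hk => ?_, fun k hk hks => ?_⟩
    · rw [key k (by omega), Nat.mod_eq_of_lt hk]
    · rw [key k hk, Nat.mod_eq_sub_mod hks, Nat.mod_eq_of_lt (by omega)]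
  · rintro ⟨h₁, h₂⟩
    refine List.ext_getElem (by simp) fun k hk _ => ?_
    have hk' : k < n := by simpa using hk
    rw [List.getElem_rotate]
    simp only [wordFactor, List.getElem_map, List.getElem_range, List.length_map,
      List.length_range]
    by_cases hks : k + s < n
    · rw [Nat.mod_eq_of_lt hks, h₁ k hks]
    · rw [Nat.mod_eq_sub_mod (by omega), Nat.mod_eq_of_lt (by omega), h₂ k hk' (by omega)]

/-- The slide drops a letter in front and appends the same letter at the end: a rotation by one. -/
theorem coe_wordFactor_succ {i n : ℕ} (h : x i = x (i + n)) :
    (wordFactor x (i + 1) n : Cycle α) = wordFactor x i n := by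
  rw [eq_comm, coe_wordFactor_eq_iff]
  rcases Nat.eq_zero_or_pos n with rfl | hn
  · exact ⟨0, by simp⟩
  refine ⟨1, hn, fun k _ => by congr 1; omega, fun k hk hk' => ?_⟩
  obtain rfl : n = k + 1 := by omega
  simpa [Nat.add_assoc, Nat.add_comm 1 k] using h.symm

/-- The factors of length `n + 1` whose first and last letters differ. -/
def unbalancedFactors (n : ℕ) : Set (List α) :=
  {l | ∃ i, x i ≠ x (i + n) ∧ wordFactor x i (n + 1) = l}

/-- The factors of length `n + 1` whose first and last letters agree. -/
def balancedFactors (n : ℕ) : Set (List α) :=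
  {l | ∃ i, x i = x (i + n) ∧ wordFactor x i (n + 1) = l}

variable [Finite α]

theorem unbalancedFactors_finite (n : ℕ) : (unbalancedFactors x n).Finite := by
  refine (List.finite_length_eq α (n + 1)).subset ?_
  rintro l ⟨i, -, rfl⟩
  exact length_wordFactor x i (n + 1)

theorem balancedFactors_finite (n : ℕ) : (balancedFactors x n).Finite := by
  refine (List.finite_length_eq α (n + 1)).subset ?_
  rintro l ⟨i, -, rfl⟩
  exact length_wordFactor x i (n + 1)

/-- If `n` is not an eventual period, sliding a window of length `n` until the next letter
differs from the first one stays inside the rotation class of the window. -/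
theorem cyclicComplexity_le_ncard_unbalancedFactors {n : ℕ}
    (hx : ∀ i, ∃ j ≥ i, x j ≠ x (j + n)) :
    cyclicComplexity x n ≤ (unbalancedFactors x n).ncard := by
  have hsub : cyclicFactors x n ⊆
      (fun l : List α => (l.dropLast : Cycle α)) '' unbalancedFactors x n := by
    rintro _ ⟨i, rfl⟩
    obtain ⟨j, hij, hj⟩ := hx i
    obtain ⟨k, rfl⟩ := Nat.exists_eq_add_of_le hij
    clear hij
    induction k generalizing i with
    | zero => exact ⟨_, ⟨i, hj, rfl⟩, by simp only [dropLast_wordFactor]⟩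
    | succ k ih =>
      by_cases h : x i = x (i + n)
      · rw [← coe_wordFactor_succ x h]
        exact ih (i + 1) (by convert hj using 2 <;> ring_nf)
      · exact ⟨_, ⟨i, h, rfl⟩, by simp only [dropLast_wordFactor]⟩
  have hfin := unbalancedFactors_finite x n
  exact (Set.ncard_le_ncard hsub (hfin.image _)).trans (Set.ncard_image_le hfin)

end Windows

/-! ### Thue–Morse recursion, forbidden patterns and aperiodicity. -/

section ThueMorse

theorem thueMorse_two_mul (n : ℕ) : thueMorse (2 * n) = thueMorse n := by
  rcases Nat.eq_zero_or_pos n with rfl | hn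
  · rfl
  · have := Nat.digits_add 2 one_lt_two 0 n (by norm_num) (Or.inr hn.ne')
    simp only [zero_add] at this
    simp [thueMorse, this]

theorem thueMorse_two_mul_add_one (n : ℕ) : thueMorse (2 * n + 1) = 1 - thueMorse n := by
  have := Nat.digits_add 2 one_lt_two 1 n (by norm_num) (Or.inl one_ne_zero)
  rw [add_comm] at this
  simp only [thueMorse, this, List.sum_cons]
  ext
  simp [Fin.sub_def]
  omega

theorem Fin.two_one_sub_eq_iff (a b : Fin 2) : 1 - a = b ↔ a ≠ b := by
  decide +revert

theorem thueMorse_odd_eq_even_iff (i j : ℕ) :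
    thueMorse (2 * i + 1) = thueMorse (2 * j) ↔ thueMorse i ≠ thueMorse j := by
  rw [thueMorse_two_mul, thueMorse_two_mul_add_one, Fin.two_one_sub_eq_iff]

theorem thueMorse_odd_eq_odd_iff (i j : ℕ) :
    thueMorse (2 * i + 1) = thueMorse (2 * j + 1) ↔ thueMorse i = thueMorse j := by
  rw [thueMorse_two_mul_add_one, thueMorse_two_mul_add_one, sub_right_inj]

theorem thueMorse_even_ne_succ {i : ℕ} (hi : Even i) : thueMorse i ≠ thueMorse (i + 1) := by
  obtain ⟨k, rfl⟩ := hi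
  rw [← two_mul, ne_comm, Ne, thueMorse_odd_eq_even_iff]
  simp

/-- The two letters straddle a block boundary, so they are `1 - t_i` and `t_{i+1}`. Alternation thus
desubstitutes to repetition. -/
theorem thueMorse_eq_of_odd_ne_succ {i : ℕ} (h : thueMorse (2 * i + 1) ≠ thueMorse (2 * i + 2)) :
    thueMorse i = thueMorse (i + 1) := by
  have := (thueMorse_odd_eq_even_iff i (i + 1)).not.1 h
  simpa using this

theorem thueMorse_no_cube (i : ℕ) :
    ¬ (thueMorse i = thueMorse (i + 1) ∧ thueMorse (i + 1) = thueMorse (i + 2)) := by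
  rintro ⟨h₁, h₂⟩
  rcases Nat.even_or_odd i with hi | hi
  · exact thueMorse_even_ne_succ hi h₁
  · exact thueMorse_even_ne_succ hi.add_one h₂

/-- The Thue–Morse word has no factor `01010` or `10101`. -/
theorem thueMorse_not_alternating (i : ℕ) :
    ¬ ∀ k < 4, thueMorse (i + k) ≠ thueMorse (i + k + 1) := by
  intro h
  rcases Nat.even_or_odd' i with ⟨a, rfl | rfl⟩
  -- Two of the four adjacent pairs straddle block boundaries, forcing `t_a = t_{a+1} = t_{a+2}`.
  · exact thueMorse_no_cube a ⟨thueMorse_eq_of_odd_ne_succ (h 1 (by norm_num)),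
      thueMorse_eq_of_odd_ne_succ (h 3 (by norm_num))⟩
  · exact thueMorse_no_cube a ⟨thueMorse_eq_of_odd_ne_succ (h 0 (by norm_num)),
      thueMorse_eq_of_odd_ne_succ (h 2 (by norm_num))⟩

theorem thueMorse_not_eventually_periodic {n : ℕ} (hn : n ≠ 0) (i : ℕ) :
    ∃ j ≥ i, thueMorse j ≠ thueMorse (j + n) := by
  by_contra! h
  induction n using Nat.strong_induction_on generalizing i with
  | _ n ih =>
    rcases Nat.even_or_odd' n with ⟨m, rfl | rfl⟩
    · refine ih m (by omega) (by omega) i fun j hj => ?_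
      have := h (2 * j) (by omega)
      rwa [← mul_add, thueMorse_two_mul, thueMorse_two_mul] at this
    -- An odd period carries the unequal pair of each block onto a block boundary; an even period,
    -- above, is halved.
    · have key : ∀ k ≥ i, thueMorse (k + m) = thueMorse (k + m + 1) := by
        intro k hk
        apply thueMorse_eq_of_odd_ne_succ
        have h₁ := h (2 * k) (by omega)
        have h₂ := h (2 * k + 1) (by omega)
        rw [show 2 * (k + m) + 1 = 2 * k + (2 * m + 1) by ring, ← h₁,
          show 2 * (k + m) + 2 = 2 * k + 1 + (2 * m + 1) by ring, ← h₂]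
        exact thueMorse_even_ne_succ (even_two_mul k)
      refine thueMorse_no_cube (i + m) ⟨key i le_rfl, ?_⟩
      simpa [Nat.add_right_comm] using key (i + 1) (by omega)

/-! ### Upper bound by desubstitution. -/

/-- The morphism `0 ↦ 01`, `1 ↦ 10` on finite words. -/
def thueMorseMorphism (l : List (Fin 2)) : List (Fin 2) :=
  l.flatMap fun a => [a, 1 - a]

theorem thueMorseMorphism_wordFactor (i n : ℕ) :
    thueMorseMorphism (wordFactor thueMorse i n) = wordFactor thueMorse (2 * i) (2 * n) := by
  induction n with
  | zero => rfl
  | succ n ih =>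
    have h₁ : wordFactor thueMorse i (n + 1) = wordFactor thueMorse i n ++ [thueMorse (i + n)] := by
      simp [wordFactor, List.range_succ]
    have h₂ : wordFactor thueMorse (2 * i) (2 * (n + 1)) =
        wordFactor thueMorse (2 * i) (2 * n) ++
          [thueMorse (2 * (i + n)), thueMorse (2 * (i + n) + 1)] := by
      simp [wordFactor, mul_add, List.range_succ, add_assoc]
    rw [h₂, ← ih, h₁, thueMorse_two_mul, thueMorse_two_mul_add_one]
    simp [thueMorseMorphism]

theorem Set.ncard_le_add_of_subset_image_union_image {α β γ : Type*} {s : Set α} {t : Set β}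
    {u : Set γ} {f : α → γ} {g : β → γ} (hs : s.Finite) (ht : t.Finite)
    (h : u ⊆ f '' s ∪ g '' t) : u.ncard ≤ s.ncard + t.ncard :=
  (Set.ncard_le_ncard h ((hs.image f).union (ht.image g))).trans <|
    (Set.ncard_union_le _ _).trans <| add_le_add (Set.ncard_image_le hs) (Set.ncard_image_le ht)

/-- A factor of odd length `2m + 1` is the image of one of length `m + 1` with its last or first
letter removed, according to the parity of its start. Its end positions have the same parity, so
equality of the end letters is unaffected. -/
theorem ncard_unbalancedFactors_two_mul_le (m : ℕ) :
    (unbalancedFactors thueMorse (2 * m)).ncard ≤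
      (unbalancedFactors thueMorse m).ncard + (unbalancedFactors thueMorse m).ncard := by
  refine Set.ncard_le_add_of_subset_image_union_image
    (f := fun l => (thueMorseMorphism l).dropLast) (g := fun l => (thueMorseMorphism l).tail)
    (unbalancedFactors_finite _ _) (unbalancedFactors_finite _ _) ?_
  rintro _ ⟨i, hi, rfl⟩
  rcases Nat.even_or_odd' i with ⟨a, rfl | rfl⟩
  · left
    rw [← mul_add, thueMorse_two_mul, thueMorse_two_mul] at hi
    refine ⟨_, ⟨a, hi, rfl⟩, ?_⟩
    dsimp only
    rw [thueMorseMorphism_wordFactor]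
    exact dropLast_wordFactor thueMorse (2 * a) (2 * m + 1)
  · right
    rw [add_right_comm, ← mul_add, Ne, thueMorse_odd_eq_odd_iff] at hi
    refine ⟨_, ⟨a, hi, rfl⟩, ?_⟩
    dsimp only
    rw [thueMorseMorphism_wordFactor]
    exact tail_wordFactor thueMorse (2 * a) (2 * m + 1)

theorem ncard_balancedFactors_two_mul_le (m : ℕ) :
    (balancedFactors thueMorse (2 * m)).ncard ≤
      (balancedFactors thueMorse m).ncard + (balancedFactors thueMorse m).ncard := by
  refine Set.ncard_le_add_of_subset_image_union_image
    (f := fun l => (thueMorseMorphism l).dropLast) (g := fun l => (thueMorseMorphism l).tail)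
    (balancedFactors_finite _ _) (balancedFactors_finite _ _) ?_
  rintro _ ⟨i, hi, rfl⟩
  rcases Nat.even_or_odd' i with ⟨a, rfl | rfl⟩
  · left
    rw [← mul_add, thueMorse_two_mul, thueMorse_two_mul] at hi
    refine ⟨_, ⟨a, hi, rfl⟩, ?_⟩
    dsimp only
    rw [thueMorseMorphism_wordFactor]
    exact dropLast_wordFactor thueMorse (2 * a) (2 * m + 1)
  · right
    rw [add_right_comm, ← mul_add, thueMorse_odd_eq_odd_iff] at hi
    refine ⟨_, ⟨a, hi, rfl⟩, ?_⟩
    dsimp only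
    rw [thueMorseMorphism_wordFactor]
    exact tail_wordFactor thueMorse (2 * a) (2 * m + 1)

/-- The end positions now have opposite parity, which complements one end letter and exchanges the
two kinds of factor. An odd start cuts a letter from both ends of an image, hence `m + 1`. -/
theorem ncard_unbalancedFactors_two_mul_add_one_le (m : ℕ) :
    (unbalancedFactors thueMorse (2 * m + 1)).ncard ≤
      (balancedFactors thueMorse m).ncard + (balancedFactors thueMorse (m + 1)).ncard := by
  refine Set.ncard_le_add_of_subset_image_union_image
    (f := thueMorseMorphism) (g := fun l => (thueMorseMorphism l).tail.dropLast)
    (balancedFactors_finite _ _) (balancedFactors_finite _ _) ?_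
  rintro _ ⟨i, hi, rfl⟩
  rcases Nat.even_or_odd' i with ⟨a, rfl | rfl⟩
  · left
    rw [← add_assoc, ← mul_add, ne_comm, Ne, thueMorse_odd_eq_even_iff, not_not] at hi
    exact ⟨_, ⟨a, hi.symm, rfl⟩, by rw [thueMorseMorphism_wordFactor]; rfl⟩
  · right
    rw [show 2 * a + 1 + (2 * m + 1) = 2 * (a + (m + 1)) by ring, Ne,
      thueMorse_odd_eq_even_iff, not_not] at hi
    refine ⟨_, ⟨a, hi, rfl⟩, ?_⟩
    dsimp only
    rw [thueMorseMorphism_wordFactor, show 2 * (m + 1 + 1) = 2 * m + 1 + 1 + 1 + 1 by ring,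
      tail_wordFactor, dropLast_wordFactor]

theorem ncard_balancedFactors_two_mul_add_one_le (m : ℕ) :
    (balancedFactors thueMorse (2 * m + 1)).ncard ≤
      (unbalancedFactors thueMorse m).ncard + (unbalancedFactors thueMorse (m + 1)).ncard := by
  refine Set.ncard_le_add_of_subset_image_union_image
    (f := thueMorseMorphism) (g := fun l => (thueMorseMorphism l).tail.dropLast)
    (unbalancedFactors_finite _ _) (unbalancedFactors_finite _ _) ?_
  rintro _ ⟨i, hi, rfl⟩
  rcases Nat.even_or_odd' i with ⟨a, rfl | rfl⟩
  · left
    rw [← add_assoc, ← mul_add, eq_comm, thueMorse_odd_eq_even_iff] at hi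
    exact ⟨_, ⟨a, hi.symm, rfl⟩, by rw [thueMorseMorphism_wordFactor]; rfl⟩
  · right
    rw [show 2 * a + 1 + (2 * m + 1) = 2 * (a + (m + 1)) by ring,
      thueMorse_odd_eq_even_iff] at hi
    refine ⟨_, ⟨a, hi, rfl⟩, ?_⟩
    dsimp only
    rw [thueMorseMorphism_wordFactor, show 2 * (m + 1 + 1) = 2 * m + 1 + 1 + 1 + 1 by ring,
      tail_wordFactor, dropLast_wordFactor]

theorem ncard_unbalancedFactors_one_le : (unbalancedFactors thueMorse 1).ncard ≤ 2 := by
  have h : unbalancedFactors thueMorse 1 ⊆ {[0, 1], [1, 0]} := by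
    rintro _ ⟨i, hi, rfl⟩
    have e : wordFactor thueMorse i (1 + 1) = [thueMorse i, thueMorse (i + 1)] := rfl
    rw [e]
    generalize thueMorse (i + 1) = b at hi
    generalize thueMorse i = a at hi
    clear e
    simp only [Set.mem_insert_iff, Set.mem_singleton_iff]
    decide +revert
  exact (Set.ncard_le_ncard h (by simp)).trans (Set.ncard_insert_le _ _ |>.trans (by simp))

theorem ncard_balancedFactors_one_le : (balancedFactors thueMorse 1).ncard ≤ 2 := by
  have h : balancedFactors thueMorse 1 ⊆ {[0, 0], [1, 1]} := by
    rintro _ ⟨i, hi, rfl⟩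
    have e : wordFactor thueMorse i (1 + 1) = [thueMorse i, thueMorse (i + 1)] := rfl
    rw [e]
    generalize thueMorse (i + 1) = b at hi
    generalize thueMorse i = a at hi
    clear e
    simp only [Set.mem_insert_iff, Set.mem_singleton_iff]
    decide +revert
  exact (Set.ncard_le_ncard h (by simp)).trans (Set.ncard_insert_le _ _ |>.trans (by simp))

theorem ncard_unbalancedFactors_le_and_ncard_balancedFactors_le {n : ℕ} (hn : n ≠ 0) :
    (unbalancedFactors thueMorse n).ncard ≤ 2 * n ∧
      (balancedFactors thueMorse n).ncard ≤ 2 * n := by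
  induction n using Nat.strong_induction_on with
  | _ n ih =>
    rcases Nat.even_or_odd' n with ⟨m, rfl | rfl⟩
    · have := ih m (by omega) (by omega)
      have := ncard_unbalancedFactors_two_mul_le m
      have := ncard_balancedFactors_two_mul_le m
      omega
    -- For `m = 0` the recursion would refer to `n = 1` itself.
    · rcases Nat.eq_zero_or_pos m with rfl | hm
      · exact ⟨ncard_unbalancedFactors_one_le, ncard_balancedFactors_one_le⟩
      · have := ih m (by omega) (by omega)
        have := ih (m + 1) (by omega) (by omega)
        have := ncard_unbalancedFactors_two_mul_add_one_le m
        have := ncard_balancedFactors_two_mul_add_one_le m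
        omega

theorem cyclicComplexity_thueMorse_le {n : ℕ} (hn : n ≠ 0) :
    cyclicComplexity thueMorse n ≤ 2 * n :=
  (cyclicComplexity_le_ncard_unbalancedFactors _ (thueMorse_not_eventually_periodic hn)).trans
    (ncard_unbalancedFactors_le_and_ncard_balancedFactors_le hn).1

/-! ### Lower bound for the factors with distinct end letters. -/

/-- Windows starting at an even and at an odd position differ. -/
theorem wordFactor_thueMorse_even_ne_odd {i j n : ℕ} (hn : 5 ≤ n) :
    wordFactor thueMorse (2 * i) n ≠ wordFactor thueMorse (2 * j + 1) n := by
  rw [Ne, wordFactor_eq_iff]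
  intro h
  refine thueMorse_not_alternating (2 * i) fun k hk => ?_
  rcases Nat.even_or_odd k with hk' | hk'
  · exact thueMorse_even_ne_succ ((even_two_mul i).add hk')
  · rw [h k (by omega), add_assoc (2 * i), h (k + 1) (by omega), ← add_assoc]
    exact thueMorse_even_ne_succ ((even_two_mul j).add_one.add_odd hk')

theorem wordFactor_eq_of_wordFactor_even_eq {i j m : ℕ}
    (h : wordFactor thueMorse (2 * i) (2 * m + 1) = wordFactor thueMorse (2 * j) (2 * m + 1)) :
    wordFactor thueMorse i (m + 1) = wordFactor thueMorse j (m + 1) := by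
  rw [wordFactor_eq_iff] at h ⊢
  intro k hk
  simpa only [← mul_add, thueMorse_two_mul] using h (2 * k) (by omega)

theorem wordFactor_eq_of_wordFactor_odd_eq {i j m : ℕ}
    (h : wordFactor thueMorse (2 * i + 1) (2 * m + 1) =
      wordFactor thueMorse (2 * j + 1) (2 * m + 1)) :
    wordFactor thueMorse i (m + 1) = wordFactor thueMorse j (m + 1) := by
  rw [wordFactor_eq_iff] at h ⊢
  intro k hk
  have := h (2 * k) (by omega)
  rwa [add_right_comm, ← mul_add, add_right_comm, ← mul_add, thueMorse_odd_eq_odd_iff] at this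

theorem Set.add_ncard_le_of_injOn_of_disjoint {α β γ : Type*} {s : Set α} {t : Set β}
    {u : Set γ} {f : α → γ} {g : β → γ} (hu : u.Finite) (hs : s.Finite) (ht : t.Finite)
    (hf : Set.MapsTo f s u) (hg : Set.MapsTo g t u) (hf' : Set.InjOn f s) (hg' : Set.InjOn g t)
    (h : ∀ a ∈ s, ∀ b ∈ t, f a ≠ g b) : s.ncard + t.ncard ≤ u.ncard := by
  rw [← hf'.ncard_image, ← hg'.ncard_image, ← Set.ncard_union_eq
    (Set.disjoint_left.2 ?_) (hs.image f) (ht.image g)]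
  · exact Set.ncard_le_ncard (Set.union_subset hf.image_subset hg.image_subset) hu
  · rintro _ ⟨a, ha, rfl⟩ ⟨b, hb, hab⟩
    exact h a ha b hb hab.symm

/-- Each factor, at a chosen occurrence `p l`, yields one window with even start and one with odd
start. Desubstitution recovers the factor from either, and length `2m + 1 ≥ 5` keeps the two
families apart. -/
theorem add_ncard_unbalancedFactors_le {m : ℕ} (hm : 2 ≤ m) :
    (unbalancedFactors thueMorse m).ncard + (unbalancedFactors thueMorse m).ncard ≤
      (unbalancedFactors thueMorse (2 * m)).ncard := by
  choose! p hp hp' using fun l (hl : l ∈ unbalancedFactors thueMorse m) => hl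
  refine Set.add_ncard_le_of_injOn_of_disjoint
    (f := fun l => wordFactor thueMorse (2 * p l) (2 * m + 1))
    (g := fun l => wordFactor thueMorse (2 * p l + 1) (2 * m + 1))
    (unbalancedFactors_finite _ _) (unbalancedFactors_finite _ _) (unbalancedFactors_finite _ _)
    (fun l hl => ⟨_, ?_, rfl⟩) (fun l hl => ⟨_, ?_, rfl⟩) (fun l hl l' hl' h => ?_)
    (fun l hl l' hl' h => ?_) (fun _ _ _ _ => wordFactor_thueMorse_even_ne_odd (by omega))
  · rw [← mul_add, thueMorse_two_mul, thueMorse_two_mul]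
    exact hp l hl
  · rw [add_right_comm, ← mul_add, Ne, thueMorse_odd_eq_odd_iff]
    exact hp l hl
  · rw [← hp' l hl, ← hp' l' hl', wordFactor_eq_of_wordFactor_even_eq h]
  · rw [← hp' l hl, ← hp' l' hl', wordFactor_eq_of_wordFactor_odd_eq h]

theorem four_le_ncard_unbalancedFactors_two : 4 ≤ (unbalancedFactors thueMorse 2).ncard := by
  have h : (({[0, 1, 1], [1, 1, 0], [1, 0, 0], [0, 0, 1]} : Finset (List (Fin 2))) :
      Set (List (Fin 2))) ⊆ unbalancedFactors thueMorse 2 := by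
    intro l hl
    simp only [Finset.coe_insert, Finset.coe_singleton, Set.mem_insert_iff,
      Set.mem_singleton_iff] at hl
    rcases hl with rfl | rfl | rfl | rfl
    · exact ⟨0, by simp [thueMorse], by simp [wordFactor, thueMorse, List.range_succ]⟩
    · exact ⟨1, by simp [thueMorse], by simp [wordFactor, thueMorse, List.range_succ]⟩
    · exact ⟨4, by simp [thueMorse], by simp [wordFactor, thueMorse, List.range_succ]⟩
    · exact ⟨5, by simp [thueMorse], by simp [wordFactor, thueMorse, List.range_succ]⟩
  have := Set.ncard_le_ncard h (unbalancedFactors_finite _ _)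
  rwa [Set.ncard_coe_finset] at this

theorem two_pow_le_ncard_unbalancedFactors (k : ℕ) :
    2 ^ (k + 2) ≤ (unbalancedFactors thueMorse (2 ^ (k + 1))).ncard := by
  induction k with
  | zero => exact four_le_ncard_unbalancedFactors_two
  | succ k ih =>
    have h := add_ncard_unbalancedFactors_le (m := 2 ^ (k + 1)) (Nat.le_self_pow (by simp) 2)
    rw [← pow_succ'] at h
    rw [pow_succ]
    omega

/-! ### Lower bound for rotation classes. -/

theorem coe_wordFactor_eq_of_even {i j m : ℕ} (hm : 3 ≤ m)
    (h : (wordFactor thueMorse (2 * i) (2 * m) : Cycle (Fin 2)) =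
      wordFactor thueMorse (2 * j) (2 * m)) :
    (wordFactor thueMorse i m : Cycle (Fin 2)) = wordFactor thueMorse j m := by
  rw [coe_wordFactor_eq_iff] at h ⊢
  obtain ⟨s, hs, h₁, h₂⟩ := h
  rcases Nat.even_or_odd' s with ⟨r, rfl | rfl⟩
  · refine ⟨r, by omega, fun k hk => ?_, fun k hk hkr => ?_⟩
    · simpa only [← mul_add, thueMorse_two_mul] using h₁ (2 * k) (by omega)
    · have := h₂ (2 * k) (by omega) (by omega)
      rwa [show 2 * k + 2 * r - 2 * m = 2 * (k + r - m) by omega, ← mul_add, ← mul_add,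
        thueMorse_two_mul, thueMorse_two_mul] at this
  -- An odd shift matches the block boundaries of one window with blocks of the other, so the first
  -- five letters alternate.
  · exfalso
    refine thueMorse_not_alternating (2 * i) fun p hp => ?_
    rcases Nat.even_or_odd' p with ⟨q, rfl | rfl⟩
    · exact thueMorse_even_ne_succ (by simp [parity_simps])
    · by_cases hq : r ≤ q
      · have e₁ := h₁ (2 * (q - r)) (by omega)
        have e₂ := h₁ (2 * (q - r) + 1) (by omega)
        rw [show 2 * (q - r) + (2 * r + 1) = 2 * q + 1 by omega] at e₁
        rw [show 2 * (q - r) + 1 + (2 * r + 1) = 2 * q + 1 + 1 by omega] at e₂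
        rw [← e₁, add_assoc, ← e₂]
        exact thueMorse_even_ne_succ (by simp [parity_simps])
      · have e₁ := h₂ (2 * (q + m - r)) (by omega) (by omega)
        have e₂ := h₂ (2 * (q + m - r) + 1) (by omega) (by omega)
        rw [show 2 * (q + m - r) + (2 * r + 1) - 2 * m = 2 * q + 1 by omega] at e₁
        rw [show 2 * (q + m - r) + 1 + (2 * r + 1) - 2 * m = 2 * q + 1 + 1 by omega] at e₂
        rw [← e₁, add_assoc, ← e₂]
        exact thueMorse_even_ne_succ (by simp [parity_simps])

theorem wordFactor_eq_of_coe_wordFactor_odd_eq {i j m : ℕ} (hm : 5 ≤ m)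
    (hi : thueMorse i ≠ thueMorse (i + m))
    (h : (wordFactor thueMorse (2 * i + 1) (2 * m) : Cycle (Fin 2)) =
      wordFactor thueMorse (2 * j + 1) (2 * m)) :
    wordFactor thueMorse i (m + 1) = wordFactor thueMorse j (m + 1) := by
  -- The end letters of the odd-start window agree; this is what excludes nontrivial even shifts.
  have wi : thueMorse (2 * i + 1) = thueMorse (2 * i + 1 + (2 * m - 1)) := by
    rw [show 2 * i + 1 + (2 * m - 1) = 2 * (i + m) by omega]
    exact (thueMorse_odd_eq_even_iff _ _).2 hi
  have of_eq : (∀ k < 2 * m, thueMorse (2 * j + 1 + k) = thueMorse (2 * i + 1 + k)) →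
      wordFactor thueMorse i (m + 1) = wordFactor thueMorse j (m + 1) := by
    intro H
    rw [wordFactor_eq_iff]
    intro k hk
    rcases Nat.eq_zero_or_pos k with rfl | hk0
    · exact ((thueMorse_odd_eq_odd_iff j i).1 (H 0 (by omega))).symm
    · have := H (2 * k - 1) (by omega)
      rwa [show 2 * j + 1 + (2 * k - 1) = 2 * (j + k) by omega,
        show 2 * i + 1 + (2 * k - 1) = 2 * (i + k) by omega, thueMorse_two_mul,
        thueMorse_two_mul, eq_comm] at this
  rw [coe_wordFactor_eq_iff] at h
  obtain ⟨s, hs, h₁, h₂⟩ := h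
  rcases Nat.eq_zero_or_pos s with rfl | hs0
  · exact of_eq fun k hk => h₁ k hk
  rcases hs.eq_or_lt with rfl | hs'
  · exact of_eq fun k hk => by simpa using h₂ k hk (by omega)
  exfalso
  rcases Nat.even_or_odd s with hse | hso
  -- Rotation puts the last and first letters of the window at `2 * i + 1` side by side; here this
  -- seam falls inside a block, where letters differ.
  · refine thueMorse_even_ne_succ (i := 2 * j + 1 + (2 * m - 1 - s)) ?_ ?_
    · rw [Nat.even_iff] at hse ⊢; omega
    · rw [h₁ _ (by omega), add_assoc (2 * j + 1), h₂ _ (by omega) (by omega),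
        show 2 * m - 1 - s + s = 2 * m - 1 by omega,
        show 2 * m - 1 - s + 1 + s - 2 * m = 0 by omega]
      exact wi.symm
  -- For odd `s` all adjacent pairs differ, except possibly at the seam, offset `2 * m - 1 - s`.
  -- Five consecutive letters avoiding the seam lie at offsets `0..4` or `4..8`; the latter needs `5
  -- ≤ m`.
  · have alt : ∀ k, k + 1 < 2 * m → k ≠ 2 * m - 1 - s →
        thueMorse (2 * j + 1 + k) ≠ thueMorse (2 * j + 1 + k + 1) := by
      intro k hk hks
      rcases Nat.even_or_odd k with hke | hko
      · by_cases hkm : k + s < 2 * m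
        · rw [h₁ k hkm, add_assoc (2 * j + 1), h₁ (k + 1) (by omega),
            show k + 1 + s = k + s + 1 by omega, ← add_assoc _ (k + s) 1]
          exact thueMorse_even_ne_succ (by rw [Nat.even_iff, Nat.odd_iff] at *; omega)
        · rw [h₂ k (by omega) (by omega), add_assoc (2 * j + 1), h₂ (k + 1) (by omega) (by omega),
            show k + 1 + s - 2 * m = k + s - 2 * m + 1 by omega, ← add_assoc (2 * i + 1)]
          exact thueMorse_even_ne_succ (by rw [Nat.even_iff, Nat.odd_iff] at *; omega)
      · exact thueMorse_even_ne_succ (by rw [Nat.even_iff, Nat.odd_iff] at *; omega)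
    by_cases hs4 : 4 ≤ 2 * m - 1 - s
    · exact thueMorse_not_alternating (2 * j + 1) fun k hk => alt k (by omega) (by omega)
    · refine thueMorse_not_alternating (2 * j + 1 + 4) fun k hk => ?_
      rw [add_assoc (2 * j + 1)]
      exact alt (4 + k) (by omega) (by omega)

theorem coe_wordFactor_even_ne_odd {i j m : ℕ} (hm : 3 ≤ m)
    (hj : thueMorse j ≠ thueMorse (j + m)) :
    (wordFactor thueMorse (2 * i) (2 * m) : Cycle (Fin 2)) ≠
      wordFactor thueMorse (2 * j + 1) (2 * m) := by
  have wj : thueMorse (2 * j + 1) = thueMorse (2 * j + 1 + (2 * m - 1)) := by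
    rw [show 2 * j + 1 + (2 * m - 1) = 2 * (j + m) by omega]
    exact (thueMorse_odd_eq_even_iff _ _).2 hj
  rw [Ne, coe_wordFactor_eq_iff]
  rintro ⟨s, hs, h₁, h₂⟩
  rcases Nat.even_or_odd s with hse | hso
  -- For even `s` the blocks of the two windows interleave, so the letters alternate. For odd `s`
  -- the equal end letters of the window at `2 * j + 1` would form a single block in the other
  -- window.
  · refine thueMorse_not_alternating (2 * j + 1) fun k hk => ?_
    rcases Nat.even_or_odd k with hke | hko
    · by_cases hkm : k + s < 2 * m
      · rw [h₁ k hkm, add_assoc (2 * j + 1),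
          h₁ (k + 1) (by rw [Nat.even_iff] at *; omega),
          show k + 1 + s = k + s + 1 by omega, ← add_assoc _ (k + s) 1]
        exact thueMorse_even_ne_succ (by rw [Nat.even_iff] at *; omega)
      · rw [h₂ k (by omega) (by omega), add_assoc (2 * j + 1), h₂ (k + 1) (by omega) (by omega),
          show k + 1 + s - 2 * m = k + s - 2 * m + 1 by omega, ← add_assoc (2 * i)]
        exact thueMorse_even_ne_succ (by rw [Nat.even_iff] at *; omega)
    · exact thueMorse_even_ne_succ (by rw [Nat.even_iff, Nat.odd_iff] at *; omega)
  · rw [Nat.odd_iff] at hso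
    have e₁ := h₁ 0 (by omega)
    have e₂ := h₂ (2 * m - 1) (by omega) (by omega)
    rw [add_zero, wj, e₂, zero_add] at e₁
    refine thueMorse_even_ne_succ (i := 2 * i + (s - 1)) (by rw [Nat.even_iff]; omega) ?_
    rw [show 2 * m - 1 + s - 2 * m = s - 1 by omega] at e₁
    rw [e₁]
    congr 1
    omega

/-- Even starts contribute one class for each class of length `m`; odd starts contribute one for
each factor of length `m + 1` with distinct end letters. The preceding lemmas show that no classes
coincide. -/
theorem cyclicComplexity_add_ncard_unbalancedFactors_le {m : ℕ} (hm : 5 ≤ m) :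
    cyclicComplexity thueMorse m + (unbalancedFactors thueMorse m).ncard ≤
      cyclicComplexity thueMorse (2 * m) := by
  choose! p hp hp' using fun l (hl : l ∈ unbalancedFactors thueMorse m) => hl
  choose! q hq using fun w (hw : w ∈ cyclicFactors thueMorse m) => hw
  refine Set.add_ncard_le_of_injOn_of_disjoint
    (f := fun w => (wordFactor thueMorse (2 * q w) (2 * m) : Cycle (Fin 2)))
    (g := fun l => (wordFactor thueMorse (2 * p l + 1) (2 * m) : Cycle (Fin 2)))
    (cyclicFactors_finite _ _) (cyclicFactors_finite _ _) (unbalancedFactors_finite _ _)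
    (fun w _ => ⟨_, rfl⟩) (fun l _ => ⟨_, rfl⟩) (fun w hw w' hw' h => ?_)
    (fun l hl l' hl' h => ?_) (fun _ _ l hl => coe_wordFactor_even_ne_odd (by omega) (hp l hl))
  · rw [hq w hw, hq w' hw', coe_wordFactor_eq_of_even (by omega) h]
  · rw [← hp' l hl, ← hp' l' hl',
      wordFactor_eq_of_coe_wordFactor_odd_eq hm (hp l hl) h]

/-- Doubling `n = 2 ^ (k + 3)` adds at least `u(n) ≥ 2n`, so the deficit `16` never grows. It is
chosen to make the base `n = 8` trivial. -/
theorem two_pow_le_cyclicComplexity_add (k : ℕ) :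
    2 * 2 ^ (k + 3) ≤ cyclicComplexity thueMorse (2 ^ (k + 3)) + 16 := by
  induction k with
  | zero => omega
  | succ k ih =>
    have h₁ := two_pow_le_ncard_unbalancedFactors (k + 2)
    have h₂ := cyclicComplexity_add_ncard_unbalancedFactors_le (m := 2 ^ (k + 3))
      (le_trans (by norm_num) (Nat.pow_le_pow_right two_pos (Nat.le_add_left 3 k)))
    rw [← pow_succ'] at h₂
    have e : 2 ^ (k + 1 + 3) = 2 * 2 ^ (k + 3) := by ring
    have e' : 2 ^ (k + 2 + 2) = 2 * 2 ^ (k + 3) := by ring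
    rw [show k + 2 + 1 = k + 3 by omega] at h₁
    rw [show k + 3 + 1 = k + 1 + 3 by omega] at h₂
    omega

/-! ### Passage to the limit. -/

theorem tendsto_cyclicComplexity_thueMorse_two_pow :
    Filter.Tendsto (fun k : ℕ => (cyclicComplexity thueMorse (2 ^ (k + 3)) : ℝ) /
      ((2 ^ (k + 3) : ℕ) : ℝ)) Filter.atTop (nhds 2) := by
  have hpow : Filter.Tendsto (fun k : ℕ => ((2 ^ (k + 3) : ℕ) : ℝ)) Filter.atTop Filter.atTop :=
    tendsto_natCast_atTop_atTop.comp
      ((tendsto_pow_atTop_atTop_of_one_lt one_lt_two).comp (Filter.tendsto_add_atTop_nat 3))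
  have hlow : Filter.Tendsto (fun k : ℕ => 2 - 16 / ((2 ^ (k + 3) : ℕ) : ℝ)) Filter.atTop
      (nhds 2) := by
    simpa using (tendsto_const_nhds (x := (2 : ℝ))).sub (hpow.const_div_atTop 16)
  refine tendsto_of_tendsto_of_tendsto_of_le_of_le hlow tendsto_const_nhds (fun k => ?_)
    fun k => ?_
  · have hpos : (0 : ℝ) < ((2 ^ (k + 3) : ℕ) : ℝ) := by positivity
    have := two_pow_le_cyclicComplexity_add k
    have h : (2 : ℝ) * ((2 ^ (k + 3) : ℕ) : ℝ) ≤
        cyclicComplexity thueMorse (2 ^ (k + 3)) + 16 := by exact_mod_cast this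
    rw [le_div_iff₀ hpos, sub_mul, div_mul_cancel₀ _ hpos.ne']
    linarith
  · refine div_le_of_le_mul₀ (by positivity) zero_le_two ?_
    have h := cyclicComplexity_thueMorse_le (n := 2 ^ (k + 3)) (by positivity)
    calc _ ≤ ((2 * 2 ^ (k + 3) : ℕ) : ℝ) := Nat.cast_le.2 h
      _ = _ := by push_cast; ring

end ThueMorse

theorem corollary4 :
    Filter.limsup
      (fun n : ℕ => (((cyclicComplexity thueMorse n : ℝ) / (n : ℝ) : ℝ) : EReal))
      Filter.atTop = 2 := by
  apply le_antisymm
  · refine Filter.limsup_le_of_le (by isBoundedDefault) (Filter.Eventually.of_forall fun n => ?_)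
    have h : (cyclicComplexity thueMorse n : ℝ) / (n : ℝ) ≤ 2 := by
      rcases Nat.eq_zero_or_pos n with rfl | hn
      -- Division by zero gives the ratio `0` at `n = 0`.
      · simp
      · refine div_le_of_le_mul₀ (by positivity) zero_le_two ?_
        exact_mod_cast cyclicComplexity_thueMorse_le hn.ne'
    exact (EReal.coe_le_coe_iff.2 h).trans_eq (by norm_cast)
  · have hsub : Filter.Tendsto (fun k : ℕ => 2 ^ (k + 3)) Filter.atTop Filter.atTop :=
      (tendsto_pow_atTop_atTop_of_one_lt one_lt_two).comp (Filter.tendsto_add_atTop_nat 3)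
    have hlim := (continuous_coe_real_ereal.tendsto 2).comp
      tendsto_cyclicComplexity_thueMorse_two_pow
    have := hlim.limsup_eq
    calc (2 : EReal) = ((2 : ℝ) : EReal) := by norm_cast
      _ = _ := this.symm
      -- The limsup along the subsequence of powers of two is at most the full limsup.
      _ ≤ _ := Filter.limsup_le_limsup_of_le (f := Filter.map (fun k : ℕ => 2 ^ (k + 3))
          Filter.atTop) (u := fun n : ℕ =>
            (((cyclicComplexity thueMorse n : ℝ) / (n : ℝ) : ℝ) : EReal)) hsub
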